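/- **Setting.** Let $\mathcal E$ be a finite-dimensional real inner product space with norm $\|\cdot\|$, identified with $\mathbb R^d$ by a choice of basis. An o-minimal structure on $(\mathbb R,+,\cdot)$ is a sequence of Boolean algebras $\mathcal O_k$ of subsets of $\mathbb R^k$ such that (i) $A\in\mathcal O_k$ implies $A\times\mathbb R,\ \mathbb R\times A\in\mathcal O_{k+1}$; (ii) the projection of $\mathbb R^{k+1}$ onto the first $k$ coordinates maps $\mathcal O_{k+1}$ into $\mathcal O_k$; (iii) $\mathcal O_k$ contains all zero sets of real polynomials in $k$ variables; (iv) the elements of $\mathcal O_1$ are exactly the finite unions of intervals and points. A map $\mathbb R^k\to\mathbb R^m$ is definable if its graph belongs to $\mathcal O_{k+m}$. An operator $L:\mathcal E\to\mathcal E$ is quasi-nonexpansive if $\|L(x)-y\|\le\|x-y\|$ for all $x\in\mathcal E$ and all $y\in\operatorname{Fix}L$. For $a>0$, a function $f$ is in $\mathrm{RV}^0_\rho$ when restricted to $(0,a]$ if it is Lebesgue measurable and positive on $(0,a]$ and $\lim_{t\to0+}f(\lambda t)/f(t)=\lambda^\rho$ for all $\lambda>0$. Let $n\ge1$ and let $L_1,\dots,L_n:\mathcal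 E\to\mathcal E$ have a common fixed point; put $C:=\bigcap_{i=1}^n\operatorname{Fix}L_i\neq\emptyset$. For a bounded set $B\subseteq\mathcal E$, a function $\psi:\mathbb R_+\to\mathbb R_+$ is a regularity function for $L_1,\dots,L_n$ over $B$ if $\operatorname{dist}(x,C)\le\psi\big(\max_{1\le i\le n}\|x-L_i(x)\|\big)$ for all $x\in B$, $\psi$ is nondecreasing with $\lim_{t\to0+}\psi(t)=\psi(0)=0$, and for some $a>0$ and some $\rho\in[0,1]$ the restriction of $\psi$ to $(0,a]$ is in $\mathrm{RV}^0_\rho$. The $L_i$ are jointly Karamata regular over $B$ (Karamata regular, if $n=1$) if such a $\psi$ exists. For $s,r\ge0$ let $\Omega_{s,r}:=\{y\in\mathcal E : \max_{1\le i\le n}\|y-L_i(y)\|\le s,\ \|y\|\le r\}$, and let $\Phi(s,r):=\max_{y\in\Omega_{s,r}}\operatorname{dist}(y,C)$ if $\Omega_{s,r}\ne\emptyset$, and $\Phi(s,r):=0$ otherwise. **Theorem.** Let $n\ge1$ and let $L_1,\dots,L_n:\mathcal E\to\mathcal E$ be continuous quasi-nonexpansive operators with $C=\bigcap_{i=1}^n\operatorname{Fix}L_i\ne\emptyset$,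 all definable in one and the same o-minimal structure, and let $B\subseteq\mathcal E$ be bounded. Then $L_1,\dots,L_n$ are jointly Karamata regular over $B$ (Karamata regular over $B$, if $n=1$). Moreover, if $C\ne\mathcal E$, then for all sufficiently large $r$ (depending on $B$) the function $\Phi(\cdot,r)$ is a regularity function for $L_1,\dots,L_n$ over $B$, and $\Phi(\cdot,r)$ is in $\mathrm{RV}^0_\rho$ when restricted to $(0,1]$, for some $\rho\in[0,1]$ (which may depend on $r$). -/

import Mathlib

open Set Filter Topology

/-! ### O-minimal structures on the real field -/

/-- An o-minimal structure on `(ℝ, +, ·)`: for every `n` a Boolean algebra `Def n` of subsets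
of `ℝⁿ`, stable under products with `ℝ` and under projections, containing the algebraic sets, and
such that the members of `Def 1` are exactly the finite unions of intervals and points. -/
structure OMinimalStructure where
  /-- the collection of definable subsets of `ℝⁿ` -/
  Def : (n : ℕ) → Set (Set (Fin n → ℝ))
  empty_mem : ∀ n, (∅ : Set (Fin n → ℝ)) ∈ Def n
  compl_mem : ∀ {n} {A : Set (Fin n → ℝ)}, A ∈ Def n → Aᶜ ∈ Def n
  union_mem : ∀ {n} {A A' : Set (Fin n → ℝ)}, A ∈ Def n → A' ∈ Def n → A ∪ A' ∈ Def n
  /-- `A × ℝ` is definable -/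
  prod_univ_mem : ∀ {n} {A : Set (Fin n → ℝ)}, A ∈ Def n →
    {x : Fin (n + 1) → ℝ | (fun i : Fin n => x i.castSucc) ∈ A} ∈ Def (n + 1)
  /-- `ℝ × A` is definable -/
  univ_prod_mem : ∀ {n} {A : Set (Fin n → ℝ)}, A ∈ Def n →
    {x : Fin (n + 1) → ℝ | (fun i : Fin n => x i.succ) ∈ A} ∈ Def (n + 1)
  /-- the projection `(x₁, …, xₙ₊₁) ↦ (x₁, …, xₙ)` maps definable sets to definable sets -/
  proj_mem : ∀ {n} {A : Set (Fin (n + 1) → ℝ)}, A ∈ Def (n + 1) →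
    (fun (x : Fin (n + 1) → ℝ) (i : Fin n) => x i.castSucc) '' A ∈ Def n
  /-- zero sets of polynomials are definable -/
  algebraic_mem : ∀ {n} (p : MvPolynomial (Fin n) ℝ),
    {x : Fin n → ℝ | MvPolynomial.eval x p = 0} ∈ Def n
  /-- Order-connected subsets of `ℝ` are exactly the intervals of all kinds (open, closed,
  half-open, bounded or not), the points and the empty set. -/
  mem_one_iff : ∀ A : Set (Fin 1 → ℝ), A ∈ Def 1 ↔
    ∃ F : Set (Set ℝ), F.Finite ∧ (∀ I ∈ F, I.OrdConnected) ∧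
      A = {x : Fin 1 → ℝ | x 0 ∈ ⋃₀ F}

/-- A map `f : ℝⁿ → ℝᵐ` is definable if its graph is a definable subset of `ℝⁿ⁺ᵐ`. -/
def OMinimalStructure.DefinableMap (O : OMinimalStructure) {n m : ℕ}
    (f : (Fin n → ℝ) → (Fin m → ℝ)) : Prop :=
  {z : Fin (n + m) → ℝ |
    (fun j : Fin m => z (Fin.natAdd n j)) = f (fun i : Fin n => z (Fin.castAdd m i))} ∈ O.Def (n + m)

/-- An operator `L : E → E` on a finite-dimensional space `E`, identified with `ℝᵈ` by means of a
basis `b`, is definable if it is definable as a map `ℝᵈ → ℝᵈ`. (As linear maps are definable,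
this does not depend on the choice of `b`.) -/
def OMinimalStructure.DefinableOperator (O : OMinimalStructure) {E : Type*}
    [AddCommGroup E] [Module ℝ E] {d : ℕ} (b : Module.Basis (Fin d) ℝ E) (L : E → E) : Prop :=
  O.DefinableMap (fun v : Fin d → ℝ => b.equivFun (L (b.equivFun.symm v)))

/-! ### Regular variation at zero -/

/-- `f` restricted to `(0, a]` is regularly varying at `0` with index `ρ`: it is Lebesgue measurable
and positive on `(0, a]`, and `f (l t) / f t → l ^ ρ` as `t → 0+`, for every `l > 0`.
(A real function is Lebesgue measurable on `(0, a]` iff it is a.e. measurable there.) -/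
structure RegularlyVaryingAtZero (f : ℝ → ℝ) (a ρ : ℝ) : Prop where
  measurable : AEMeasurable f (MeasureTheory.volume.restrict (Ioc 0 a))
  pos : ∀ t ∈ Ioc 0 a, 0 < f t
  tendsto : ∀ l : ℝ, 0 < l → Tendsto (fun t => f (l * t) / f t) (𝓝[>] 0) (𝓝 (l ^ ρ))

/-! ### Karamata regularity -/

section Karamata

variable {E : Type*} [NormedAddCommGroup E]

/-- `L` is quasi-nonexpansive. -/
def QuasiNonexpansive (L : E → E) : Prop :=
  ∀ x, ∀ y ∈ Function.fixedPoints L, ‖L x - y‖ ≤ ‖x - y‖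

/-- The set `C` of common fixed points of the operators `L i`. -/
def commonFix {n : ℕ} (L : Fin n → E → E) : Set E :=
  ⋂ i, Function.fixedPoints (L i)

/-- The joint residual `max_i ‖x - L i x‖` (for `n ≥ 1` the supremum is that of a nonempty finite
family, hence a maximum). -/
noncomputable def jointResidual {n : ℕ} (L : Fin n → E → E) (x : E) : ℝ :=
  ⨆ i, ‖x - L i x‖

/-- `ψ : ℝ₊ → ℝ₊` is a regularity function for the `L i` over `B`. A function on `ℝ₊` is
represented by a function on `ℝ` of which only the values on `[0, ∞)` are considered. -/
structure IsRegularityFunction {n : ℕ} (L : Fin n → E → E) (B : Set E) (ψ : ℝ → ℝ) : Prop where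
  nonneg : ∀ t, 0 ≤ t → 0 ≤ ψ t
  error_bound : ∀ x ∈ B, Metric.infDist x (commonFix L) ≤ ψ (jointResidual L x)
  monotone : MonotoneOn ψ (Ici 0)
  map_zero : ψ 0 = 0
  tendsto_zero : Tendsto ψ (𝓝[>] 0) (𝓝 0)
  regularlyVarying : ∃ a > 0, ∃ ρ ∈ Icc (0 : ℝ) 1, RegularlyVaryingAtZero ψ a ρ

/-- The operators `L i`, having a common fixed point, are jointly Karamata regular over the
bounded set `B` (Karamata regular, if `n = 1`). -/
def JointlyKaramataRegular {n : ℕ} (L : Fin n → E → E) (B : Set E) : Prop :=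
  ∃ ψ : ℝ → ℝ, IsRegularityFunction L B ψ

/-- The set `Ω_{r,s}` of the points `y` with `max_i ‖y - L i y‖ ≤ r` and `‖y‖ ≤ s`. -/
def sublevelSet {n : ℕ} (L : Fin n → E → E) (r s : ℝ) : Set E :=
  {y | jointResidual L y ≤ r ∧ ‖y‖ ≤ s}

open Classical in
/-- The best error bound function `Φ(r, s)`: the maximum of the distance to the common fixed point
set over `Ω_{r,s}`, and `0` if `Ω_{r,s}` is empty. -/
noncomputable def bestErrorBound {n : ℕ} (L : Fin n → E → E) (r s : ℝ) : ℝ :=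
  if (sublevelSet L r s).Nonempty then
    sSup ((fun y => Metric.infDist y (commonFix L)) '' sublevelSet L r s)
  else 0

/-- For continuous operators on a proper space the supremum in `bestErrorBound` is a maximum. -/
theorem bestErrorBound_isGreatest [ProperSpace E] {n : ℕ} (hn : 1 ≤ n) (L : Fin n → E → E)
    (hL : ∀ i, Continuous (L i)) (r s : ℝ) (h : (sublevelSet L r s).Nonempty) :
    IsGreatest ((fun y => Metric.infDist y (commonFix L)) '' sublevelSet L r s)
      (bestErrorBound L r s) := by
  have : Nonempty (Fin n) := ⟨⟨0, hn⟩⟩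
  have hset : sublevelSet L r s = (⋂ i, {y | ‖y - L i y‖ ≤ r}) ∩ Metric.closedBall 0 s := by
    ext y
    simp only [sublevelSet, jointResidual, mem_ofPred_eq, mem_inter_iff, mem_iInter,
      mem_closedBall_zero_iff]
    rw [ciSup_le_iff (Set.finite_range _).bddAbove]
  have hc : IsCompact (sublevelSet L r s) := by
    rw [hset]
    refine (isCompact_closedBall (0 : E) s).inter_left (isClosed_iInter fun i => ?_)
    exact isClosed_le (continuous_id.sub (hL i)).norm continuous_const
  rw [bestErrorBound, if_pos h]
  exact (hc.image (Metric.continuous_infDist_pt _)).isGreatest_sSup (h.image _)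

end Karamata

/-! Suppose `C ≠ E` and write `Φ(s) = Φ(s, r)` with `r` large. Compactness gives `Φ(s) → 0`.
Quasi-nonexpansiveness bounds the residual by twice the distance to `C`, so points on a segment
leaving `C` show `Φ(s) ≥ s / 2` for small `s` (`half_le_bestErrorBound`). For fixed `l > 0` and `c ≥
0`, the relation `c Φ(t) < Φ(l t)` is a first-order condition on `t`, so o-minimality makes it
eventually true or eventually false as `t → 0+` (`eventually_mul_bestErrorBound_lt_or_not`). The
ratio `Φ(l t) / Φ(t)` thus settles on one side of every level and has a limit `g l`. For `l > 1` a
limit above `l` would force `Φ` to decay faster than linearly (`not_eventually_mul_lt`). Hence `g`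
is multiplicative with `1 ≤ g l ≤ l` for `l ≥ 1`, and `g l = l ^ ρ` with `ρ ∈ [0, 1]`. If `C = E`,
the identity is a regularity function. -/

namespace OMinimalStructure

variable {O : OMinimalStructure}

/-! ### Closure properties of definable sets -/

theorem univ_mem (O : OMinimalStructure) (n : ℕ) : (univ : Set (Fin n → ℝ)) ∈ O.Def n := by
  simpa using O.compl_mem (O.empty_mem n)

theorem inter_mem {n : ℕ} {A A' : Set (Fin n → ℝ)} (h : A ∈ O.Def n) (h' : A' ∈ O.Def n) :
    A ∩ A' ∈ O.Def n := by
  simpa [compl_union] using O.compl_mem (O.union_mem (O.compl_mem h) (O.compl_mem h'))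

theorem iInter_mem {n : ℕ} {κ : Type*} [Finite κ] {A : κ → Set (Fin n → ℝ)}
    (h : ∀ i, A i ∈ O.Def n) : (⋂ i, A i) ∈ O.Def n := by
  have key : ∀ s : Set κ, s.Finite → (⋂ i ∈ s, A i) ∈ O.Def n := by
    intro s hs
    induction s, hs using Set.Finite.induction_on with
    | empty => simpa using O.univ_mem n
    | insert _ _ ih => rw [biInter_insert]; exact inter_mem (h _) ih
  simpa using key univ finite_univ

theorem univ_prod_iterate {n : ℕ} {A : Set (Fin n → ℝ)} (h : A ∈ O.Def n) (m : ℕ) :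
    {x : Fin (n + m) → ℝ | (fun i : Fin n => x (i.addNat m)) ∈ A} ∈ O.Def (n + m) := by
  induction m with
  | zero => exact h
  | succ m ih => exact O.univ_prod_mem ih

theorem exists_append_mem {m k : ℕ} {A : Set (Fin (m + k) → ℝ)} (h : A ∈ O.Def (m + k)) :
    {x : Fin m → ℝ | ∃ y : Fin k → ℝ, Fin.append x y ∈ A} ∈ O.Def m := by
  have hsplit : ∀ {k : ℕ} (z : Fin (m + k) → ℝ),
      Fin.append (fun i => z (Fin.castAdd k i)) (fun i => z (Fin.natAdd m i)) = z :=
    fun z => Fin.append_castAdd_natAdd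
  have hproj : {x : Fin m → ℝ | ∃ y : Fin k → ℝ, Fin.append x y ∈ A} =
      (fun (z : Fin (m + k) → ℝ) (i : Fin m) => z (Fin.castAdd k i)) '' A := by
    apply Set.ext
    intro x
    constructor
    · rintro ⟨y, hy⟩
      exact ⟨_, hy, funext fun i => Fin.append_left x y i⟩
    · rintro ⟨z, hz, rfl⟩
      exact ⟨fun i => z (Fin.natAdd m i), by rwa [hsplit]⟩
  rw [hproj]
  clear hproj
  induction k with
  | zero => simpa using h
  | succ k ih =>
    have := ih (O.proj_mem (n := m + k) h)
    rwa [image_image] at this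

/-- Coordinates may be permuted, repeated or dropped: adjoin copies `y i` of `x (g i)`, tied to them
by polynomial equations, require `y ∈ A`, and project `y` away. -/
theorem comp_mem {n m : ℕ} {A : Set (Fin n → ℝ)} (h : A ∈ O.Def n) (g : Fin n → Fin m) :
    {x : Fin m → ℝ | x ∘ g ∈ A} ∈ O.Def m := by
  have h1 : {x : Fin (m + n) → ℝ | (fun i => x (Fin.natAdd m i)) ∈ A} ∈ O.Def (m + n) := by
    -- The iterated product lives in dimension `n + m`, not `m + n`; a free `k` absorbs the cast.
    have aux : ∀ k (hk : k = n + m), {x : Fin k → ℝ |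
        (fun i : Fin n => x ((i.addNat m).cast hk.symm)) ∈ A} ∈ O.Def k := by
      rintro k rfl
      exact univ_prod_iterate h m
    convert aux (m + n) (add_comm m n) using 7
    exact Fin.ext (add_comm _ _)
  have h2 : ∀ i : Fin n, {x : Fin (m + n) → ℝ |
      x (Fin.natAdd m i) = x (Fin.castAdd n (g i))} ∈ O.Def (m + n) := by
    intro i
    convert O.algebraic_mem (MvPolynomial.X (Fin.natAdd m i) -
      MvPolynomial.X (Fin.castAdd n (g i))) using 3
    simp [sub_eq_zero]
  convert exists_append_mem (inter_mem h1 (iInter_mem h2)) using 1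
  ext x
  simp only [mem_ofPred_eq, mem_inter_iff, mem_iInter, Fin.append_left, Fin.append_right]
  constructor
  · intro hx
    exact ⟨x ∘ g, hx, fun i => rfl⟩
  · rintro ⟨y, hy, hyx⟩
    rwa [show x ∘ g = y from funext fun i => (hyx i).symm]

/-! ### Definable predicates and first-order formulas -/

/-- A predicate on real assignments of the variables in `ι` is definable if it becomes a member of
`O.Def n` under every renaming of its variables into `Fin n`. -/
def IsDef (O : OMinimalStructure) {ι : Type} (P : (ι → ℝ) → Prop) : Prop :=
  ∀ (n : ℕ) (g : ι → Fin n), {x : Fin n → ℝ | P (x ∘ g)} ∈ O.Def n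

/-- A real function of the variables in `ι` that is given by a polynomial. -/
def IsPolyFun {ι : Type} (f : (ι → ℝ) → ℝ) : Prop :=
  ∃ p : MvPolynomial ι ℝ, ∀ x, MvPolynomial.eval x p = f x

namespace IsPolyFun

variable {ι : Type} {f g : (ι → ℝ) → ℝ}

theorem coord (i : ι) : IsPolyFun fun x : ι → ℝ => x i := ⟨.X i, by simp⟩

theorem const (c : ℝ) : IsPolyFun fun _ : ι → ℝ => c := ⟨.C c, by simp⟩

theorem mul (hf : IsPolyFun f) (hg : IsPolyFun g) : IsPolyFun fun x => f x * g x := by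
  obtain ⟨p, hp⟩ := hf
  obtain ⟨q, hq⟩ := hg
  exact ⟨p * q, by simp [hp, hq]⟩

theorem sub (hf : IsPolyFun f) (hg : IsPolyFun g) : IsPolyFun fun x => f x - g x := by
  obtain ⟨p, hp⟩ := hf
  obtain ⟨q, hq⟩ := hg
  exact ⟨p - q, by simp [hp, hq]⟩

theorem sum {κ : Type*} {s : Finset κ} {f : κ → (ι → ℝ) → ℝ} (hf : ∀ k, IsPolyFun (f k)) :
    IsPolyFun fun x => ∑ k ∈ s, f k x := by
  choose p hp using hf
  exact ⟨∑ k ∈ s, p k, by simp [hp]⟩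

end IsPolyFun

namespace IsDef

variable {ι κ : Type} {P Q : (ι → ℝ) → Prop}

theorem of_mem {n : ℕ} {A : Set (Fin n → ℝ)} (h : A ∈ O.Def n) : O.IsDef fun x => x ∈ A :=
  fun _ g => comp_mem h g

theorem mem {n : ℕ} {P : (Fin n → ℝ) → Prop} (h : O.IsDef P) : {x | P x} ∈ O.Def n :=
  h n id

theorem comp (h : O.IsDef P) (g : ι → κ) : O.IsDef fun x : κ → ℝ => P (x ∘ g) :=
  fun n g' => h n (g' ∘ g)

theorem and (hP : O.IsDef P) (hQ : O.IsDef Q) : O.IsDef fun x => P x ∧ Q x :=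
  fun n g => inter_mem (hP n g) (hQ n g)

theorem not (hP : O.IsDef P) : O.IsDef fun x => ¬ P x :=
  fun n g => O.compl_mem (hP n g)

theorem imp (hP : O.IsDef P) (hQ : O.IsDef Q) : O.IsDef fun x => P x → Q x := by
  simpa [not_and] using (hP.and hQ.not).not

theorem forall_finite {τ : Type*} [Finite τ] {P : τ → (ι → ℝ) → Prop} (h : ∀ i, O.IsDef (P i)) :
    O.IsDef fun x => ∀ i, P i x := by
  intro n g
  simpa only [ofPred_forall] using iInter_mem fun i => h i n g

/-- Bound variables enter as a summand of the index type, so nested quantifiers need no arithmetic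
in `Fin`. -/
theorem exists_vec {k : ℕ} {Q : (ι → ℝ) → (Fin k → ℝ) → Prop}
    (h : O.IsDef fun z : ι ⊕ Fin k → ℝ => Q (z ∘ Sum.inl) (z ∘ Sum.inr)) :
    O.IsDef fun x => ∃ y, Q x y := by
  intro n g
  convert exists_append_mem
    (h (n + k) (Sum.elim (fun i => Fin.castAdd k (g i)) (fun j => Fin.natAdd n j))) using 5 with x y
  simp only [mem_ofPred_eq]
  congr! 1
  · ext i; simp
  · ext i; simp

theorem forall_vec {k : ℕ} {Q : (ι → ℝ) → (Fin k → ℝ) → Prop}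
    (h : O.IsDef fun z : ι ⊕ Fin k → ℝ => Q (z ∘ Sum.inl) (z ∘ Sum.inr)) :
    O.IsDef fun x => ∀ y, Q x y := by
  simpa using (exists_vec (Q := fun x y => ¬ Q x y) h.not).not

theorem poly_eq_zero {f : (ι → ℝ) → ℝ} (hf : IsPolyFun f) : O.IsDef fun x => f x = 0 := by
  obtain ⟨p, hp⟩ := hf
  intro n g
  convert O.algebraic_mem (MvPolynomial.rename g p) using 3 with x
  rw [MvPolynomial.eval_rename, hp]

/-- The order comes from the algebraic sets: a real is nonnegative iff it is a square, and the root
is projected away. -/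
theorem poly_nonneg {f : (ι → ℝ) → ℝ} (hf : IsPolyFun f) : O.IsDef fun x => 0 ≤ f x := by
  have h : O.IsDef fun x : ι → ℝ => ∃ y : Fin 1 → ℝ, f x - y 0 * y 0 = 0 := by
    refine exists_vec (poly_eq_zero ?_)
    refine IsPolyFun.sub ?_ ((IsPolyFun.coord (Sum.inr 0)).mul (IsPolyFun.coord (Sum.inr 0)))
    obtain ⟨p, hp⟩ := hf
    exact ⟨MvPolynomial.rename Sum.inl p, fun x => by rw [MvPolynomial.eval_rename, hp]⟩
  convert h using 3 with x
  constructor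
  · intro hx
    exact ⟨fun _ => √(f x), by rw [Real.mul_self_sqrt hx, sub_self]⟩
  · rintro ⟨y, hy⟩
    rw [sub_eq_zero.1 hy]
    exact mul_self_nonneg _

theorem poly_le {f g : (ι → ℝ) → ℝ} (hf : IsPolyFun f) (hg : IsPolyFun g) :
    O.IsDef fun x => f x ≤ g x := by
  simpa using poly_nonneg (O := O) (hg.sub hf)

theorem poly_lt {f g : (ι → ℝ) → ℝ} (hf : IsPolyFun f) (hg : IsPolyFun g) :
    O.IsDef fun x => f x < g x := by
  simpa using (poly_le (O := O) hg hf).not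

/-- A definable predicate of one real variable is eventually true or eventually false at `0+`. -/
theorem eventually_or_eventually_not {P : ℝ → Prop}
    (h : O.IsDef fun x : Fin 1 → ℝ => P (x 0)) :
    (∀ᶠ t in 𝓝[>] (0 : ℝ), P t) ∨ ∀ᶠ t in 𝓝[>] (0 : ℝ), ¬ P t := by
  obtain ⟨F, hF, hI, hPF⟩ := (O.mem_one_iff _).1 h.mem
  have hP : ∀ t, P t ↔ ∃ I ∈ F, t ∈ I := fun t => by
    simpa using Set.ext_iff.1 hPF (fun _ => t)
  have key : ∀ I ∈ F, (∀ᶠ t in 𝓝[>] (0 : ℝ), t ∈ I) ∨ ∀ᶠ t in 𝓝[>] (0 : ℝ), t ∉ I := by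
    intro I hIF
    by_cases hfr : ∃ᶠ t in 𝓝[>] (0 : ℝ), t ∈ I
    · left
      -- An interval with points arbitrarily close to `0+` contains all of `(0, a)`: each `t` there
      -- lies between two of its points.
      obtain ⟨a, haI, ha⟩ := (hfr.and_eventually self_mem_nhdsWithin).exists
      filter_upwards [Ioo_mem_nhdsGT ha] with t ht
      obtain ⟨b, hbI, hb⟩ := (hfr.and_eventually (Ioo_mem_nhdsGT ht.1)).exists
      exact (hI I hIF).out hbI haI ⟨hb.2.le, ht.2.le⟩
    · exact Or.inr (not_frequently.1 hfr)
  by_cases hex : ∃ I ∈ F, ∀ᶠ t in 𝓝[>] (0 : ℝ), t ∈ I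
  · obtain ⟨I, hIF, hIt⟩ := hex
    exact Or.inl (hIt.mono fun t ht => (hP t).2 ⟨I, hIF, ht⟩)
  · right
    have := (hF.eventually_all (l := 𝓝[>] (0 : ℝ)) (p := fun I t => t ∉ I)).2
      fun I hIF => (key I hIF).resolve_left fun hIt => hex ⟨I, hIF, hIt⟩
    filter_upwards [this] with t ht hPt
    obtain ⟨I, hIF, htI⟩ := (hP t).1 hPt
    exact ht I hIF htI

end IsDef

end OMinimalStructure

/-! ### Regular variation from non-oscillating ratios -/

/-- If `f (l * t) > c * f t` near `0` for some `c > l > 1`, then `f` is not bounded below by a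
positive multiple of `t`. -/
theorem not_eventually_mul_lt {f : ℝ → ℝ} {a l c : ℝ} (ha : 0 < a)
    (hlin : ∀ᶠ t in 𝓝[>] (0 : ℝ), a * t ≤ f t) (hl : 1 < l) (hc : l < c) :
    ¬ ∀ᶠ t in 𝓝[>] (0 : ℝ), c * f t < f (l * t) := by
  intro h
  have hl0 : 0 < l := by linarith
  have hc0 : 0 < c := by linarith
  obtain ⟨ε, hε, hball⟩ := mem_nhdsGT_iff_exists_Ioo_subset.1 (hlin.and h)
  replace hε : 0 < ε := hε
  set t₀ := ε / 2 with ht₀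
  have hmem : ∀ k : ℕ, t₀ * (l⁻¹) ^ k ∈ Ioo 0 ε := fun k => by
    have h1 : (l⁻¹) ^ k ≤ 1 := pow_le_one₀ (by positivity) (inv_le_one_of_one_le₀ hl.le)
    have h2 : 0 < (l⁻¹) ^ k := by positivity
    exact ⟨by positivity, by nlinarith⟩
  have hdecay : ∀ k : ℕ, c ^ k * f (t₀ * (l⁻¹) ^ k) ≤ f t₀ := by
    intro k
    induction k with
    | zero => simp
    | succ k ih =>
      have h1 := (hball (hmem (k + 1))).2
      have h2 : l * (t₀ * (l⁻¹) ^ (k + 1)) = t₀ * (l⁻¹) ^ k := by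
        rw [pow_succ]; field_simp
      rw [h2] at h1
      calc c ^ (k + 1) * f (t₀ * (l⁻¹) ^ (k + 1))
          = c ^ k * (c * f (t₀ * (l⁻¹) ^ (k + 1))) := by ring
        _ ≤ c ^ k * f (t₀ * (l⁻¹) ^ k) := by gcongr
        _ ≤ f t₀ := ih
  -- Geometric decay against the linear lower bound: `(c / l) ^ k` would stay bounded although `c >
  -- l`.
  have hbound : ∀ k : ℕ, a * t₀ * (c / l) ^ k ≤ f t₀ := fun k => by
    refine le_trans ?_ (hdecay k)
    calc a * t₀ * (c / l) ^ k = c ^ k * (a * (t₀ * (l⁻¹) ^ k)) := by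
          rw [div_eq_mul_inv, mul_pow]; ring
      _ ≤ _ := by gcongr; exact (hball (hmem k)).1
  have hat : 0 < a * t₀ := by positivity
  obtain ⟨k, hk⟩ := pow_unbounded_of_one_lt (f t₀ / (a * t₀)) ((one_lt_div hl0).2 hc)
  rw [div_lt_iff₀ hat] at hk
  linarith [hbound k]

/-- A function `g` with `g (l * m) = g l * g m` and `1 ≤ g l ≤ l` for `l ≥ 1` is a power. -/
theorem exists_eq_rpow_of_mul {g : ℝ → ℝ} (hmul : ∀ l m, 0 < l → 0 < m → g (l * m) = g l * g m)
    (h1 : ∀ l, 1 ≤ l → 1 ≤ g l) (hle : ∀ l, 1 ≤ l → g l ≤ l) :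
    ∃ ρ ∈ Icc (0 : ℝ) 1, ∀ l, 0 < l → g l = l ^ ρ := by
  have hone : g 1 = 1 := le_antisymm (hle 1 le_rfl) (h1 1 le_rfl)
  have hpos : ∀ l, 0 < l → 0 < g l := by
    intro l hl
    rcases le_total 1 l with h | h
    · linarith [h1 l h]
    · have h2 : 1 ≤ g l⁻¹ := h1 _ ((one_le_inv₀ hl).2 h)
      have h3 : g l * g l⁻¹ = 1 := by
        rw [← hmul l l⁻¹ hl (inv_pos.2 hl), mul_inv_cancel₀ hl.ne', hone]
      by_contra hneg
      nlinarith
  -- In logarithmic coordinates `g` is additive and squeezed between `0` and `u` for `u ≥ 0`, hence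
  -- continuous and linear; `ρ` is its slope.
  let φ : ℝ →+ ℝ :=
    { toFun := fun u => Real.log (g (Real.exp u))
      map_zero' := by simp [hone]
      map_add' := fun u v => by
        rw [Real.exp_add, hmul _ _ (Real.exp_pos u) (Real.exp_pos v),
          Real.log_mul (hpos _ (Real.exp_pos u)).ne' (hpos _ (Real.exp_pos v)).ne'] }
  have hφ : ∀ u, 0 ≤ u → 0 ≤ φ u ∧ φ u ≤ u := by
    intro u hu
    have hu1 : 1 ≤ Real.exp u := Real.one_le_exp hu
    refine ⟨Real.log_nonneg (h1 _ hu1), ?_⟩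
    calc Real.log (g (Real.exp u)) ≤ Real.log (Real.exp u) :=
          Real.log_le_log (hpos _ (Real.exp_pos u)) (hle _ hu1)
      _ = u := Real.log_exp u
  have hbound : ∀ u, ‖φ u‖ ≤ 1 * ‖u‖ := by
    intro u
    rw [one_mul]
    rcases le_total 0 u with hu | hu
    · rw [Real.norm_of_nonneg hu, Real.norm_of_nonneg (hφ u hu).1]
      exact (hφ u hu).2
    · obtain ⟨h2, h3⟩ := hφ (-u) (by linarith)
      rw [← norm_neg u, ← norm_neg (φ u), ← map_neg, Real.norm_of_nonneg h2,
        Real.norm_of_nonneg (by linarith)]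
      exact h3
  have hcont : Continuous φ := AddMonoidHomClass.continuous_of_bound φ 1 hbound
  refine ⟨φ 1, ⟨(hφ 1 zero_le_one).1, (hφ 1 zero_le_one).2⟩, fun l hl => ?_⟩
  have h4 : φ (Real.log l) = Real.log l * φ 1 := by
    have := map_real_smul φ hcont (Real.log l) 1
    simpa using this
  have h5 : φ (Real.log l) = Real.log (g l) := by
    change Real.log (g (Real.exp (Real.log l))) = _
    rw [Real.exp_log hl]
  rw [Real.rpow_def_of_pos hl, ← h4, h5, Real.exp_log (hpos l hl)]

/-- A positive nondecreasing function that is bounded below by a positive multiple of `t` and whose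
ratios `f (l * t) / f t` do not oscillate around any level is regularly varying at `0`, with index
in `[0, 1]`. -/
theorem exists_regularlyVarying_index {f : ℝ → ℝ} {a : ℝ} (ha : 0 < a)
    (hmono : MonotoneOn f (Ioi 0)) (hpos : ∀ t, 0 < t → 0 < f t)
    (hlin : ∀ᶠ t in 𝓝[>] (0 : ℝ), a * t ≤ f t)
    (htame : ∀ l c : ℝ, 0 < l → 0 ≤ c → (∀ᶠ t in 𝓝[>] (0 : ℝ), c * f t < f (l * t)) ∨
      ∀ᶠ t in 𝓝[>] (0 : ℝ), ¬ c * f t < f (l * t)) :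
    ∃ ρ ∈ Icc (0 : ℝ) 1, ∀ l : ℝ, 0 < l →
      Tendsto (fun t => f (l * t) / f t) (𝓝[>] 0) (𝓝 (l ^ ρ)) := by
  have hev : ∀ᶠ t in 𝓝[>] (0 : ℝ), 0 < t := self_mem_nhdsWithin
  have hupper : ∀ l c : ℝ, 1 < l → l < c → ∀ᶠ t in 𝓝[>] (0 : ℝ), f (l * t) / f t ≤ c := by
    intro l c hl hc
    filter_upwards [(htame l c (by linarith) (by linarith)).resolve_left
      (not_eventually_mul_lt ha hlin hl hc), hev] with t ht ht0
    exact (div_le_iff₀ (hpos t ht0)).2 (not_lt.1 ht)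
  have hbdd : ∀ l : ℝ, 0 < l → ∃ c, ∀ᶠ t in 𝓝[>] (0 : ℝ), f (l * t) / f t ≤ c := by
    intro l hl
    rcases lt_or_ge 1 l with h | h
    · exact ⟨l + 1, hupper l _ h (by linarith)⟩
    · refine ⟨1, hev.mono fun t ht => (div_le_one (hpos t ht)).2 ?_⟩
      exact hmono (mul_pos hl ht) ht (by nlinarith)
  have hlim : ∀ l : ℝ, 0 < l → ∃ g, Tendsto (fun t => f (l * t) / f t) (𝓝[>] 0) (𝓝 g) := by
    intro l hl
    obtain ⟨c, hc⟩ := hbdd l hl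
    have hnn : ∀ᶠ t in 𝓝[>] (0 : ℝ), 0 ≤ f (l * t) / f t := hev.mono fun t ht =>
      (div_pos (hpos _ (mul_pos hl ht)) (hpos t ht)).le
    refine tendsto_of_no_upcrossings dense_univ ?_ ⟨c, hc⟩ ⟨0, hnn⟩
    rintro p - q - hpq ⟨hp, hq⟩
    -- `htame` covers only levels `≥ 0`; a negative level is never undershot, the ratio being
    -- nonnegative.
    rcases lt_or_ge p 0 with hp0 | hp0
    · obtain ⟨t, ht1, ht2⟩ := (hp.and_eventually hnn).exists
      linarith
    · rcases htame l p hl hp0 with h | h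
      · obtain ⟨t, ht1, ht2, ht3⟩ := (hp.and_eventually (h.and hev)).exists
        exact absurd ((div_lt_iff₀ (hpos t ht3)).1 ht1) ht2.le.not_gt
      · obtain ⟨t, ht1, ht2, ht3⟩ := (hq.and_eventually (h.and hev)).exists
        exact ht2 ((lt_div_iff₀ (hpos t ht3)).1 (hpq.trans ht1))
  choose! g hg using hlim
  have hmul : ∀ l m, 0 < l → 0 < m → g (l * m) = g l * g m := by
    intro l m hl hm
    have hscale : Tendsto (fun t : ℝ => m * t) (𝓝[>] 0) (𝓝[>] 0) := by
      refine tendsto_nhdsWithin_of_tendsto_nhds_of_eventually_within _ ?_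
        (hev.mono fun t ht => mul_pos hm ht)
      have : Tendsto (fun t : ℝ => m * t) (𝓝 0) (𝓝 (m * 0)) := tendsto_id.const_mul m
      rw [mul_zero] at this
      exact this.mono_left nhdsWithin_le_nhds
    -- `f (l m t) / f t` factors through `f (m t)`.
    refine tendsto_nhds_unique (hg _ (mul_pos hl hm))
      ((((hg l hl).comp hscale).mul (hg m hm)).congr' ?_)
    filter_upwards [hev] with t ht
    have h1 := (hpos t ht).ne'
    have h2 := (hpos _ (mul_pos hm ht)).ne'
    simp only [Function.comp_apply, mul_assoc]
    field_simp
  obtain ⟨ρ, hρ, hgρ⟩ := exists_eq_rpow_of_mul hmul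
    (fun l hl => ge_of_tendsto (hg l (by linarith)) (hev.mono fun t ht =>
      (one_le_div (hpos t ht)).2 (hmono ht (mul_pos (by linarith) ht) (by nlinarith))))
    (fun l hl => by
      rcases hl.eq_or_lt with rfl | hl
      · refine le_of_tendsto (hg 1 one_pos) (hev.mono fun t ht => ?_)
        rw [one_mul, div_self (hpos t ht).ne']
      · exact le_of_forall_gt_imp_ge_of_dense fun c hc =>
          le_of_tendsto (hg l (by linarith)) (hupper l c hl hc))
  exact ⟨ρ, hρ, fun l hl => hgρ l hl ▸ hg l hl⟩

/-! ### Definability of norms and residuals -/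

namespace OMinimalStructure

section Operators

variable {O : OMinimalStructure} {ι : Type} {E : Type*} [NormedAddCommGroup E]
  [InnerProductSpace ℝ E] {d : ℕ} (b : Module.Basis (Fin d) ℝ E)

/-- The inner product makes the squared norm a quadratic form in the coordinates, with the Gram
matrix of `b`; `b` need not be orthonormal. -/
theorem IsPolyFun.norm_sq {f : Fin d → (ι → ℝ) → ℝ} (hf : ∀ i, IsPolyFun (f i)) :
    IsPolyFun fun x => ‖b.equivFun.symm fun i => f i x‖ ^ 2 := by
  have h : ∀ v : Fin d → ℝ, ‖b.equivFun.symm v‖ ^ 2 =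
      ∑ i, ∑ j, v i * v j * inner ℝ (b i) (b j) := fun v => by
    rw [← real_inner_self_eq_norm_sq, b.equivFun_symm_apply, sum_inner]
    simp_rw [inner_sum, real_inner_smul_left, real_inner_smul_right, mul_assoc]
  simp_rw [h]
  exact .sum fun i => .sum fun j => ((hf i).mul (hf j)).mul (.const _)

theorem IsPolyFun.norm_sub_sq (g h : Fin d → ι) :
    IsPolyFun fun x : ι → ℝ => ‖b.equivFun.symm (x ∘ g) - b.equivFun.symm (x ∘ h)‖ ^ 2 := by
  simp_rw [← map_sub]
  exact norm_sq b fun i => (coord (g i)).sub (coord (h i))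

variable {b} {L : E → E}

theorem DefinableOperator.isDef_graph (hL : O.DefinableOperator b L) (g h : Fin d → ι) :
    O.IsDef fun x : ι → ℝ => b.equivFun.symm (x ∘ h) = L (b.equivFun.symm (x ∘ g)) := by
  have h1 := (IsDef.of_mem hL).comp (Fin.append g h)
  have h2 : ∀ x : ι → ℝ, (b.equivFun.symm (x ∘ h) = L (b.equivFun.symm (x ∘ g))) ↔
      x ∘ h = b.equivFun (L (b.equivFun.symm (x ∘ g))) := fun x =>
    LinearEquiv.symm_apply_eq _
  simp_rw [h2]
  simp only [mem_ofPred_eq, Function.comp_apply, Fin.append_left, Fin.append_right] at h1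
  exact h1

theorem DefinableOperator.isDef_residual_le (hL : O.DefinableOperator b L) (g : Fin d → ι)
    {f : (ι → ℝ) → ℝ} (hf : IsPolyFun f) :
    O.IsDef fun x : ι → ℝ =>
      ‖b.equivFun.symm (x ∘ g) - L (b.equivFun.symm (x ∘ g))‖ ^ 2 ≤ f x := by
  have h : ∀ x : ι → ℝ, ‖b.equivFun.symm (x ∘ g) - L (b.equivFun.symm (x ∘ g))‖ ^ 2 ≤ f x ↔
      ∃ u : Fin d → ℝ, b.equivFun.symm u = L (b.equivFun.symm (x ∘ g)) ∧
        ‖b.equivFun.symm (x ∘ g) - b.equivFun.symm u‖ ^ 2 ≤ f x := by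
    refine fun x => ⟨fun hx => ⟨b.equivFun (L (b.equivFun.symm (x ∘ g))), ?_, ?_⟩, ?_⟩
    · exact b.equivFun.symm_apply_apply _
    · rwa [b.equivFun.symm_apply_apply]
    · rintro ⟨u, hu, hx⟩
      rwa [hu] at hx
  simp_rw [h]
  refine IsDef.exists_vec ((hL.isDef_graph (Sum.inl ∘ g) Sum.inr).and
    (IsDef.poly_le (IsPolyFun.norm_sub_sq b (Sum.inl ∘ g) Sum.inr) ?_))
  obtain ⟨p, hp⟩ := hf
  exact ⟨MvPolynomial.rename Sum.inl p, fun x => by rw [MvPolynomial.eval_rename, hp]⟩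

end Operators

end OMinimalStructure

/-! ### Metric properties of the best error bound -/

section BestErrorBound

variable {E : Type*} [NormedAddCommGroup E] {n : ℕ} {L : Fin n → E → E}

theorem jointResidual_le_iff (hn : 1 ≤ n) {x : E} {s : ℝ} :
    jointResidual L x ≤ s ↔ ∀ i, ‖x - L i x‖ ≤ s := by
  have : Nonempty (Fin n) := ⟨⟨0, hn⟩⟩
  exact ciSup_le_iff (finite_range _).bddAbove

theorem jointResidual_nonneg (x : E) : 0 ≤ jointResidual L x :=
  Real.iSup_nonneg fun _ => norm_nonneg _

omit [NormedAddCommGroup E] in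
theorem mem_commonFix_iff {x : E} : x ∈ commonFix L ↔ ∀ i, L i x = x := by
  simp [commonFix, Function.IsFixedPt]

theorem jointResidual_nonpos_iff (hn : 1 ≤ n) {x : E} :
    jointResidual L x ≤ 0 ↔ x ∈ commonFix L := by
  simp [jointResidual_le_iff hn, mem_commonFix_iff, sub_eq_zero, eq_comm]

theorem isClosed_commonFix (hL : ∀ i, Continuous (L i)) : IsClosed (commonFix L) :=
  isClosed_iInter fun i => isClosed_eq (hL i) continuous_id

theorem isClosed_jointResidual_le (hn : 1 ≤ n) (hL : ∀ i, Continuous (L i)) (s : ℝ) :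
    IsClosed {x | jointResidual L x ≤ s} := by
  simp_rw [jointResidual_le_iff hn, ofPred_forall]
  exact isClosed_iInter fun i => isClosed_le (continuous_id.sub (hL i)).norm continuous_const

theorem jointResidual_le_two_mul_infDist (hn : 1 ≤ n) (hfix : (commonFix L).Nonempty)
    (hq : ∀ i, QuasiNonexpansive (L i)) (x : E) :
    jointResidual L x ≤ 2 * Metric.infDist x (commonFix L) := by
  rw [jointResidual_le_iff hn]
  intro i
  rw [← div_le_iff₀' two_pos, Metric.le_infDist hfix]
  intro y hy
  have h1 := hq i x y (mem_commonFix_iff.1 hy i)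
  have h2 : ‖x - L i x‖ ≤ ‖x - y‖ + ‖L i x - y‖ := by
    rw [← sub_sub_sub_cancel_right x (L i x) y]
    exact norm_sub_le _ _
  rw [dist_eq_norm]
  linarith

theorem sublevelSet_mono {s s' : ℝ} (h : s ≤ s') (r : ℝ) :
    sublevelSet L s r ⊆ sublevelSet L s' r :=
  fun _ hy => ⟨hy.1.trans h, hy.2⟩

variable [ProperSpace E]

theorem infDist_le_bestErrorBound (hn : 1 ≤ n) (hL : ∀ i, Continuous (L i)) {s r : ℝ} {y : E}
    (hy : y ∈ sublevelSet L s r) : Metric.infDist y (commonFix L) ≤ bestErrorBound L s r :=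
  (bestErrorBound_isGreatest hn L hL s r ⟨y, hy⟩).2 (mem_image_of_mem _ hy)

theorem bestErrorBound_nonneg (hn : 1 ≤ n) (hL : ∀ i, Continuous (L i)) (s r : ℝ) :
    0 ≤ bestErrorBound L s r := by
  by_cases h : (sublevelSet L s r).Nonempty
  · exact Metric.infDist_nonneg.trans (infDist_le_bestErrorBound hn hL h.some_mem)
  · rw [bestErrorBound, if_neg h]

/-- The default value `0` keeps monotonicity valid on all of `ℝ`, negative `s` included;
measurability follows from it. -/
theorem bestErrorBound_mono (hn : 1 ≤ n) (hL : ∀ i, Continuous (L i)) (r : ℝ) :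
    Monotone fun s => bestErrorBound L s r := by
  intro s s' hs
  by_cases h : (sublevelSet L s r).Nonempty
  · obtain ⟨y, hy, hys⟩ := (bestErrorBound_isGreatest hn L hL s r h).1
    dsimp only at hys ⊢
    rw [← hys]
    exact infDist_le_bestErrorBound hn hL (sublevelSet_mono hs r hy)
  · dsimp only
    rw [bestErrorBound, if_neg h]
    exact bestErrorBound_nonneg hn hL _ _

theorem bestErrorBound_zero (hn : 1 ≤ n) (hL : ∀ i, Continuous (L i)) (r : ℝ) :
    bestErrorBound L 0 r = 0 := by
  by_cases h : (sublevelSet L 0 r).Nonempty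
  · obtain ⟨y, hy, hys⟩ := (bestErrorBound_isGreatest hn L hL 0 r h).1
    rw [← hys]
    exact Metric.infDist_zero_of_mem ((jointResidual_nonpos_iff hn).1 hy.1)
  · rw [bestErrorBound, if_neg h]

theorem tendsto_bestErrorBound (hn : 1 ≤ n) (hL : ∀ i, Continuous (L i)) (r : ℝ) :
    Tendsto (fun s => bestErrorBound L s r) (𝓝[>] 0) (𝓝 0) := by
  rw [Metric.tendsto_nhds]
  intro ε hε
  by_contra hcon
  have hfreq : ∃ᶠ s in 𝓝[>] (0 : ℝ), ε ≤ bestErrorBound L s r := by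
    simpa [abs_of_nonneg (bestErrorBound_nonneg hn hL _ r)] using hcon
  have hall : ∀ s : ℝ, 0 < s → ε ≤ bestErrorBound L s r := by
    intro s hs
    obtain ⟨s', hs', hmem⟩ := (hfreq.and_eventually (Ioo_mem_nhdsGT hs)).exists
    exact hs'.trans (bestErrorBound_mono hn hL r hmem.2.le)
  -- Nested nonempty compact sets: a common point has zero residual, so lies in `C`, yet is at
  -- distance at least `ε` from `C`.
  let K : ℕ → Set E := fun k =>
    ({x | jointResidual L x ≤ 1 / (k + 1 : ℝ)} ∩ {x | ε ≤ Metric.infDist x (commonFix L)}) ∩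
      Metric.closedBall 0 r
  have hclosed : IsClosed {x | ε ≤ Metric.infDist x (commonFix L)} :=
    isClosed_le continuous_const (Metric.continuous_infDist_pt _)
  have hKc : ∀ k, IsCompact (K k) := fun k =>
    (isCompact_closedBall (0 : E) r).inter_left ((isClosed_jointResidual_le hn hL _).inter hclosed)
  have hKne : ∀ k, (K k).Nonempty := by
    intro k
    have h1 := hall (1 / (k + 1 : ℝ)) Nat.one_div_pos_of_nat
    have hne : (sublevelSet L (1 / (k + 1 : ℝ)) r).Nonempty := by
      by_contra h
      rw [bestErrorBound, if_neg h] at h1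
      linarith
    obtain ⟨y, hy, hys⟩ := (bestErrorBound_isGreatest hn L hL _ r hne).1
    refine ⟨y, ⟨hy.1, ?_⟩, mem_closedBall_zero_iff.2 hy.2⟩
    rw [← hys] at h1
    exact h1
  obtain ⟨x, hx⟩ := IsCompact.nonempty_iInter_of_sequence_nonempty_isCompact_isClosed K
    (fun k x hx => ⟨⟨le_trans (b := 1 / ((k + 1 : ℕ) + 1 : ℝ)) hx.1.1
      (Nat.one_div_le_one_div k.le_succ), hx.1.2⟩, hx.2⟩)
    hKne (hKc 0) fun k => (hKc k).isClosed
  rw [mem_iInter] at hx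
  have hx0 : jointResidual L x ≤ 0 :=
    ge_of_tendsto tendsto_one_div_add_atTop_nhds_zero_nat
      (Eventually.of_forall fun k => (hx k).1.1)
  have h2 : ε ≤ Metric.infDist x (commonFix L) := (hx 0).1.2
  rw [Metric.infDist_zero_of_mem ((jointResidual_nonpos_iff hn).1 hx0)] at h2
  linarith

/-- Both distances are attained, so the strict inequality can be expressed by quantifiers over
points of `C`, without infima. -/
theorem mul_infDist_lt_infDist_iff {C : Set E} (hC : IsClosed C) (hne : C.Nonempty) {c : ℝ}
    (hc : 0 ≤ c) (y z : E) : c * Metric.infDist z C < Metric.infDist y C ↔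
      ∃ w ∈ C, ∀ v ∈ C, c * ‖z - w‖ < ‖y - v‖ := by
  constructor
  · intro h
    obtain ⟨w, hw, hzw⟩ := hC.exists_infDist_eq_dist hne z
    refine ⟨w, hw, fun v hv => ?_⟩
    rw [← dist_eq_norm, ← dist_eq_norm, ← hzw]
    exact h.trans_le (Metric.infDist_le_dist_of_mem hv)
  · rintro ⟨w, hw, h⟩
    obtain ⟨v, hv, hyv⟩ := hC.exists_infDist_eq_dist hne y
    rw [hyv, dist_eq_norm]
    refine lt_of_le_of_lt ?_ (h v hv)
    rw [← dist_eq_norm]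
    exact mul_le_mul_of_nonneg_left (Metric.infDist_le_dist_of_mem hw) hc

theorem mul_bestErrorBound_lt_iff (hn : 1 ≤ n) (hL : ∀ i, Continuous (L i)) {s s' r c : ℝ}
    (hc : 0 ≤ c) (h : (sublevelSet L s r).Nonempty) (h' : (sublevelSet L s' r).Nonempty) :
    c * bestErrorBound L s r < bestErrorBound L s' r ↔
      ∃ y ∈ sublevelSet L s' r, ∀ z ∈ sublevelSet L s r,
        c * Metric.infDist z (commonFix L) < Metric.infDist y (commonFix L) := by
  constructor
  · intro hlt
    obtain ⟨y, hy, hys⟩ := (bestErrorBound_isGreatest hn L hL s' r h').1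
    refine ⟨y, hy, fun z hz => ?_⟩
    dsimp only at hys
    rw [hys]
    exact (mul_le_mul_of_nonneg_left (infDist_le_bestErrorBound hn hL hz) hc).trans_lt hlt
  · rintro ⟨y, hy, hlt⟩
    obtain ⟨z, hz, hzs⟩ := (bestErrorBound_isGreatest hn L hL s r h).1
    rw [← hzs]
    exact (hlt z hz).trans_le (infDist_le_bestErrorBound hn hL hy)

end BestErrorBound

/-! ### Definability of the comparison of `Φ(t)` and `Φ(l t)` -/

section Definable

open OMinimalStructure

variable {E : Type*} [NormedAddCommGroup E] [InnerProductSpace ℝ E] {d : ℕ}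
  {b : Module.Basis (Fin d) ℝ E} {O : OMinimalStructure} {n : ℕ} {L : Fin n → E → E}

omit [InnerProductSpace ℝ E] in
theorem mem_sublevelSet_iff_sq (hn : 1 ≤ n) {s r : ℝ} (hs : 0 ≤ s) (hr : 0 ≤ r) {y : E} :
    y ∈ sublevelSet L s r ↔ (∀ i, ‖y - L i y‖ ^ 2 ≤ s ^ 2) ∧ ‖y‖ ^ 2 ≤ r ^ 2 := by
  simp_rw [sq_le_sq₀ (norm_nonneg _) hs, sq_le_sq₀ (norm_nonneg _) hr, sublevelSet,
    mem_ofPred_eq, jointResidual_le_iff hn]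

theorem isDef_commonFix (hdef : ∀ i, O.DefinableOperator b (L i)) {ι : Type} (g : Fin d → ι) :
    O.IsDef fun x : ι → ℝ => b.equivFun.symm (x ∘ g) ∈ commonFix L := by
  simp_rw [mem_commonFix_iff, eq_comm (b := b.equivFun.symm _)]
  exact .forall_finite fun i => (hdef i).isDef_graph g g

theorem isDef_sublevelSet_sq (hdef : ∀ i, O.DefinableOperator b (L i)) (l r : ℝ) {ι : Type}
    (g : Fin d → ι) (k : ι) :
    O.IsDef fun x : ι → ℝ =>
      (∀ i, ‖b.equivFun.symm (x ∘ g) - L i (b.equivFun.symm (x ∘ g))‖ ^ 2 ≤ (l * x k) ^ 2) ∧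
        ‖b.equivFun.symm (x ∘ g)‖ ^ 2 ≤ r ^ 2 := by
  refine .and (.forall_finite fun i => (hdef i).isDef_residual_le g ?_)
    (.poly_le (IsPolyFun.norm_sq b fun i => .coord (g i)) (.const _))
  simp_rw [sq]
  exact ((IsPolyFun.const l).mul (.coord k)).mul ((IsPolyFun.const l).mul (.coord k))

theorem eventually_mul_bestErrorBound_lt_or_not [ProperSpace E] (hn : 1 ≤ n)
    (hL : ∀ i, Continuous (L i)) (hdef : ∀ i, O.DefinableOperator b (L i)) {r : ℝ} {x₀ : E}
    (hx₀ : x₀ ∈ commonFix L) (hr : ‖x₀‖ ≤ r) {l c : ℝ} (hl : 0 < l) (hc : 0 ≤ c) :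
    (∀ᶠ t in 𝓝[>] (0 : ℝ), c * bestErrorBound L t r < bestErrorBound L (l * t) r) ∨
      ∀ᶠ t in 𝓝[>] (0 : ℝ), ¬ c * bestErrorBound L t r < bestErrorBound L (l * t) r := by
  have hr0 : 0 ≤ r := (norm_nonneg _).trans hr
  let p : (Fin d → ℝ) → E := b.equivFun.symm
  let Ω : ℝ → (Fin d → ℝ) → Prop := fun s y =>
    (∀ i, ‖p y - L i (p y)‖ ^ 2 ≤ s ^ 2) ∧ ‖p y‖ ^ 2 ≤ r ^ 2
  -- The factor `1` lets `isDef_sublevelSet_sq` serve both radii; squaring makes all norm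
  -- comparisons polynomial.
  have hdefP : O.IsDef fun x : Fin 1 → ℝ => ∃ y, Ω (l * x 0) y ∧ ∀ z, Ω (1 * x 0) z →
      ∃ w, p w ∈ commonFix L ∧ ∀ v, p v ∈ commonFix L →
        c ^ 2 * ‖p z - p w‖ ^ 2 < ‖p y - p v‖ ^ 2 := by
    refine .exists_vec (.and (isDef_sublevelSet_sq hdef l r Sum.inr (Sum.inl 0)) ?_)
    refine .forall_vec (.imp (isDef_sublevelSet_sq hdef 1 r Sum.inr (Sum.inl (Sum.inl 0))) ?_)
    refine .exists_vec (.and (isDef_commonFix hdef Sum.inr) ?_)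
    refine .forall_vec (.imp (isDef_commonFix hdef Sum.inr) ?_)
    exact .poly_lt
      ((IsPolyFun.const _).mul (.norm_sub_sq b (Sum.inl ∘ Sum.inl ∘ Sum.inr) (Sum.inl ∘ Sum.inr)))
      (.norm_sub_sq b (Sum.inl ∘ Sum.inl ∘ Sum.inl ∘ Sum.inr) Sum.inr)
  have hsurj : Function.Surjective p := b.equivFun.symm.surjective
  have hne : ∀ s : ℝ, 0 ≤ s → (sublevelSet L s r).Nonempty := fun s hs =>
    ⟨x₀, ((jointResidual_nonpos_iff hn).2 hx₀).trans hs, hr⟩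
  have hiff : ∀ t : ℝ, 0 < t → (c * bestErrorBound L t r < bestErrorBound L (l * t) r ↔
      ∃ y, Ω (l * t) y ∧ ∀ z, Ω (1 * t) z → ∃ w, p w ∈ commonFix L ∧ ∀ v, p v ∈ commonFix L →
        c ^ 2 * ‖p z - p w‖ ^ 2 < ‖p y - p v‖ ^ 2) := by
    intro t ht
    have hlt : 0 ≤ l * t := (mul_pos hl ht).le
    rw [mul_bestErrorBound_lt_iff hn hL hc (hne t ht.le) (hne _ hlt)]
    simp_rw [mul_infDist_lt_infDist_iff (isClosed_commonFix hL) ⟨x₀, hx₀⟩ hc,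
      mem_sublevelSet_iff_sq hn hlt hr0, mem_sublevelSet_iff_sq hn ht.le hr0,
      hsurj.exists, hsurj.forall, Ω, one_mul, ← mul_pow]
    simp_rw [sq_lt_sq₀ (mul_nonneg hc (norm_nonneg _)) (norm_nonneg _)]
  rcases IsDef.eventually_or_eventually_not (P := fun t => ∃ y, Ω (l * t) y ∧ ∀ z, Ω (1 * t) z →
    ∃ w, p w ∈ commonFix L ∧ ∀ v, p v ∈ commonFix L →
      c ^ 2 * ‖p z - p w‖ ^ 2 < ‖p y - p v‖ ^ 2) hdefP with h | h
  · left
    filter_upwards [h, self_mem_nhdsWithin] with t ht ht0 using (hiff t ht0).2 ht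
  · right
    filter_upwards [h, self_mem_nhdsWithin] with t ht ht0 using fun hcon => ht ((hiff t ht0).1 hcon)

end Definable

/-! ### Linear lower bound and conclusion -/

/-- Along the segment from a common fixed point to another point the distance to the set of common
fixed points takes all small values. -/
theorem half_le_bestErrorBound {E : Type*} [NormedAddCommGroup E] [NormedSpace ℝ E]
    [ProperSpace E] {n : ℕ} {L : Fin n → E → E} (hn : 1 ≤ n) (hL : ∀ i, Continuous (L i))
    (hq : ∀ i, QuasiNonexpansive (L i)) {x₀ x₁ : E} (hx₀ : x₀ ∈ commonFix L) {r : ℝ}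
    (hr₀ : ‖x₀‖ ≤ r) (hr₁ : ‖x₁‖ ≤ r) {s : ℝ} (hs : 0 ≤ s)
    (hs₁ : s ≤ 2 * Metric.infDist x₁ (commonFix L)) : s / 2 ≤ bestErrorBound L s r := by
  have h0 : Metric.infDist x₀ (commonFix L) = 0 := Metric.infDist_zero_of_mem hx₀
  -- A point at distance `s / 2` from `C` has residual at most `s`.
  obtain ⟨y, hy, hys⟩ := (convex_segment x₀ x₁).isPreconnected.intermediate_value
    (left_mem_segment ℝ x₀ x₁) (right_mem_segment ℝ x₀ x₁)
    (Metric.continuous_infDist_pt (commonFix L)).continuousOn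
    (show s / 2 ∈ Icc _ _ from ⟨by rw [h0]; linarith, by linarith⟩)
  rw [← hys]
  refine infDist_le_bestErrorBound hn hL ⟨?_, ?_⟩
  · linarith [jointResidual_le_two_mul_infDist hn ⟨x₀, hx₀⟩ hq y]
  · have := (convex_closedBall (0 : E) r).segment_subset (mem_closedBall_zero_iff.2 hr₀)
      (mem_closedBall_zero_iff.2 hr₁) hy
    exact mem_closedBall_zero_iff.1 this

/-- Here `Φ` vanishes identically and is not regularly varying, so another function is needed. -/
theorem isRegularityFunction_id_of_commonFix_eq_univ {E : Type*} [NormedAddCommGroup E] {n : ℕ}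
    {L : Fin n → E → E} (h : commonFix L = univ) (B : Set E) : IsRegularityFunction L B id where
  nonneg _ ht := ht
  error_bound x _ := by
    rw [Metric.infDist_zero_of_mem (h ▸ mem_univ x)]
    exact jointResidual_nonneg x
  monotone := monotone_id.monotoneOn _
  map_zero := rfl
  tendsto_zero := tendsto_id'.2 nhdsWithin_le_nhds
  regularlyVarying := by
    refine ⟨1, one_pos, 1, ⟨zero_le_one, le_rfl⟩, aemeasurable_id, fun t ht => ht.1, fun l _ => ?_⟩
    refine tendsto_const_nhds.congr' ?_
    filter_upwards [self_mem_nhdsWithin] with t (ht : 0 < t)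
    rw [Real.rpow_one, id, id, mul_div_cancel_right₀ _ ht.ne']
theorem theorem5p6 {E : Type*} [NormedAddCommGroup E] [InnerProductSpace ℝ E]
    [FiniteDimensional ℝ E] {d : ℕ} (b : Module.Basis (Fin d) ℝ E)
    (O : OMinimalStructure) {n : ℕ} (hn : 1 ≤ n) (L : Fin n → E → E)
    (hcont : ∀ i, Continuous (L i))
    (hfix : (commonFix L).Nonempty)
    (hquasi : ∀ i, QuasiNonexpansive (L i))
    (hdef : ∀ i, O.DefinableOperator b (L i))
    (B : Set E) (hB : Bornology.IsBounded B) :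
    JointlyKaramataRegular L B ∧
    (commonFix L ≠ Set.univ →
      ∃ r₀ : ℝ, ∀ r ≥ r₀,
        IsRegularityFunction L B (fun t => bestErrorBound L t r) ∧
        ∃ ρ ∈ Set.Icc (0 : ℝ) 1, RegularlyVaryingAtZero (fun t => bestErrorBound L t r) 1 ρ) := by
  have : ProperSpace E := FiniteDimensional.proper ℝ E
  have main : commonFix L ≠ Set.univ →
      ∃ r₀ : ℝ, ∀ r ≥ r₀,
        IsRegularityFunction L B (fun t => bestErrorBound L t r) ∧
        ∃ ρ ∈ Set.Icc (0 : ℝ) 1,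
          RegularlyVaryingAtZero (fun t => bestErrorBound L t r) 1 ρ := by
    intro hC
    obtain ⟨x₀, hx₀⟩ := hfix
    obtain ⟨x₁, hx₁⟩ := (ne_univ_iff_exists_notMem _).1 hC
    obtain ⟨R, hR⟩ := hB.exists_norm_le
    refine ⟨max R (max ‖x₀‖ ‖x₁‖), fun r hr => ?_⟩
    have hRr : R ≤ r := (le_max_left _ _).trans hr
    have hr₀ : ‖x₀‖ ≤ r := ((le_max_left _ _).trans (le_max_right _ _)).trans hr
    have hr₁ : ‖x₁‖ ≤ r := ((le_max_right _ _).trans (le_max_right _ _)).trans hr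
    have hδ : 0 < Metric.infDist x₁ (commonFix L) :=
      ((isClosed_commonFix hcont).notMem_iff_infDist_pos ⟨x₀, hx₀⟩).1 hx₁
    set δ := Metric.infDist x₁ (commonFix L)
    have hmono := bestErrorBound_mono hn hcont r
    have hhalf : ∀ s, 0 ≤ s → s ≤ 2 * δ → s / 2 ≤ bestErrorBound L s r := fun s hs hsδ =>
      half_le_bestErrorBound hn hcont hquasi hx₀ hr₀ hr₁ hs hsδ
    -- Beyond `2 * δ` the linear bound is unavailable; monotonicity carries positivity over.
    have hpos : ∀ t, 0 < t → 0 < bestErrorBound L t r := fun t ht =>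
      calc 0 < min t (2 * δ) / 2 := by positivity
        _ ≤ bestErrorBound L (min t (2 * δ)) r := hhalf _ (by positivity) (min_le_right _ _)
        _ ≤ bestErrorBound L t r := hmono (min_le_left _ _)
    have hlin : ∀ᶠ t in 𝓝[>] (0 : ℝ), 1 / 2 * t ≤ bestErrorBound L t r := by
      filter_upwards [Ioo_mem_nhdsGT (show 0 < 2 * δ by positivity)] with t ht
      linarith [hhalf t ht.1.le ht.2.le]
    obtain ⟨ρ, hρ, hlim⟩ := exists_regularlyVarying_index one_half_pos (hmono.monotoneOn _) hpos hlin
      fun l c hl hc => eventually_mul_bestErrorBound_lt_or_not hn hcont hdef hx₀ hr₀ hl hc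
    have hRV : RegularlyVaryingAtZero (fun t => bestErrorBound L t r) 1 ρ :=
      ⟨hmono.measurable.aemeasurable, fun t ht => hpos t ht.1, hlim⟩
    exact ⟨{
      nonneg := fun t _ => bestErrorBound_nonneg hn hcont t r
      error_bound := fun x hx => infDist_le_bestErrorBound hn hcont ⟨le_rfl, (hR x hx).trans hRr⟩
      monotone := hmono.monotoneOn _
      map_zero := bestErrorBound_zero hn hcont r
      tendsto_zero := tendsto_bestErrorBound hn hcont r
      regularlyVarying := ⟨1, one_pos, ρ, hρ, hRV⟩ }, ρ, hρ, hRV⟩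
  refine ⟨?_, main⟩
  by_cases hC : commonFix L = univ
  · exact ⟨id, isRegularityFunction_id_of_commonFix_eq_univ hC B⟩
  · obtain ⟨r₀, h⟩ := main hC
    exact ⟨_, (h r₀ le_rfl).1⟩
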